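/- **Setting.** Let $G=(V,E)$ be a finite connected simple graph with at least two vertices, $\gamma>0$, $N\ge 0$, and let $\tilde d_G(u,w)$ be the number of edges of a shortest path from $u$ to $w$. Put the vertices of $G$ as affinely independent points and let $$G^c=\{u+t(w-u)\;:\;u,w\in V,\ u\sim w,\ t\in[-\tfrac12,\tfrac12]\},$$ where every edge is given length $\sqrt\gamma$; the range of layer $u$ is the part $\{u+t(w-u): w\sim u,\ |t|\le\frac12\}$. Let $[G^c]_0$ be the set of injective continuous paths $p:[a,b]\to G^c$ parametrized by arc length, and let $\mathcal M$ be $\mathbb R^N\times G^c$ with the charts $\mathbb R^N\times p$, $p\in[G^c]_0$, with coordinates $(x,z)\in\mathbb R^N\times[a,b]$. A path $p$ contains layer $u$ if $p(c)=u$ for some $c$ with $[c-\frac{\sqrt\gamma}2,c+\frac{\sqrt\gamma}2]\subseteq[a,b]$. A *Gaussian cylinder* on layer $u$ is a distribution on $\mathcal M$ which, in some chart $\mathbb R^N\times p$ whose path contains layer $u$, is the product of a Gaussian on $\mathbb R^N$ and the uniform distribution on $[c-\frac{\sqrt\gamma}2,c+\frac{\sqrt\gamma}2]$. Its projection to layer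 $u$ is the distribution on $\mathbb R^N$ obtained by integrating out the last variable over the range of layer $u$. For distributions $\mu_0,\mu_1$ on $\mathcal M$ let $$C_{\mathcal M}(\mu_0,\mu_1)=\inf_{p}\ \inf_{\pi}\int \|x-y\|^2+|z_1-z_2|^2\ \pi(dx\,dz_1,dy\,dz_2),$$ where $p$ runs over $[G^c]_0$ and $\pi$ over the couplings of $\mu_0$ and $\mu_1$ carried by the chart $\mathbb R^N\times p$, in the coordinates of that chart ($\inf\emptyset=\infty$). **Theorem.** Let $u,w\in V$ and let $\nu_0,\nu_1$ be Gaussian distributions on $\mathbb R^N$. The optimal transport cost on $\mathcal M$ between Gaussian cylinders lifting $\nu_0$ on layer $u$ and $\nu_1$ on layer $w$, $$d_{\mathcal M}=\inf\{C_{\mathcal M}(\mu_0,\mu_1)\;:\;\mu_0,\mu_1\text{ Gaussian cylinders on layers }u,w\text{ with projections }\nu_0,\nu_1\},$$ is $$d_{\mathcal M}=\mathcal W_2(\nu_0,\nu_1)^2+\gamma\,\tilde d_G(u,w)^2,$$ and there are two such Gaussian cylinders $\mu_0,\mu_1$ with $C_{\mathcal M}(\mu_0,\mu_1)$ equal to this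 value. -/

import Mathlib

open MeasureTheory ProbabilityTheory Set
open scoped ENNReal NNReal

noncomputable section

namespace VectorGMM

/-- `π` is a coupling of `μ` and `ν`. -/
def IsCoupling {X Y : Type*} [MeasurableSpace X] [MeasurableSpace Y]
    (π : Measure (X × Y)) (μ : Measure X) (ν : Measure Y) : Prop :=
  π.map Prod.fst = μ ∧ π.map Prod.snd = ν

/-- The Wasserstein-2 distance of two distributions on `ℝ^N`. -/
def W2 {N : ℕ} (μ ν : Measure (EuclideanSpace ℝ (Fin N))) : ℝ≥0∞ :=
  (⨅ (π : Measure (EuclideanSpace ℝ (Fin N) × EuclideanSpace ℝ (Fin N)))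
    (_ : IsCoupling π μ ν), ∫⁻ q, ENNReal.ofReal (‖q.1 - q.2‖ ^ 2) ∂π) ^ (1 / 2 : ℝ)

section Graph

variable {V : Type*} [Fintype V] [DecidableEq V]

/-- The abstract vertex `u`, as a point of `ℝ^V`. The vertices are affinely independent and, in the
sup norm of `V → ℝ`, any two distinct ones have distance `√γ`, the thickness of a layer. -/
def vertexPoint (γ : ℝ) (u : V) : V → ℝ := Pi.single u (Real.sqrt γ)

/-- The range of layer `u`: all points `u + t (w - u)` with `w ∼ u` and `t ∈ [-1/2, 1/2]`. -/
def layerRange (G : SimpleGraph V) (γ : ℝ) (u : V) : Set (V → ℝ) :=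
  {z | ∃ w, G.Adj u w ∧ ∃ t ∈ Icc (-(1 / 2) : ℝ) (1 / 2),
    z = vertexPoint γ u + t • (vertexPoint γ w - vertexPoint γ u)}

/-- The continuous graph `{u + t (w - u) | u ∼ w, t ∈ [-1/2, 1/2]}`. -/
def contGraph (G : SimpleGraph V) (γ : ℝ) : Set (V → ℝ) :=
  ⋃ u, layerRange G γ u

/-- An acyclic path on the continuous graph, parametrized by arc length on `[left, right]`.
Being injective on `[left, right]`, it meets no vertex twice and does not turn back. (The values of
the function outside `[left, right]` play no role.) -/
structure AcyclicPath (G : SimpleGraph V) (γ : ℝ) where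
  left : ℝ
  right : ℝ
  left_lt_right : left < right
  toFun : ℝ → contGraph G γ
  continuous_toFun : Continuous toFun
  injOn : InjOn toFun (Icc left right)
  unitSpeed : HasUnitSpeedOn toFun (Icc left right)

/-- The path `p` passes through the vertex `u` at parameter `c` and contains a whole layer there:
half an edge length on both sides of `u`. -/
def AcyclicPath.ContainsLayerAt {G : SimpleGraph V} {γ : ℝ} (p : AcyclicPath G γ)
    (u : V) (c : ℝ) : Prop :=
  (p.toFun c : V → ℝ) = vertexPoint γ u ∧
    Icc (c - Real.sqrt γ / 2) (c + Real.sqrt γ / 2) ⊆ Icc p.left p.right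

/-- The space `ℝ^N × G^c` underlying the manifold. -/
abbrev Manifold (N : ℕ) (G : SimpleGraph V) (γ : ℝ) : Type _ :=
  EuclideanSpace ℝ (Fin N) × contGraph G γ

/-- The chart `ℝ^N × p` in coordinates: the inverse of the coordinate map. Its coordinate domain is
`ℝ^N × [left, right]`. -/
def AcyclicPath.chart {G : SimpleGraph V} {γ : ℝ} (N : ℕ) (p : AcyclicPath G γ) :
    EuclideanSpace ℝ (Fin N) × ℝ → Manifold N G γ :=
  fun q => (q.1, p.toFun q.2)

/-- The coordinate domain of the chart `ℝ^N × p`. -/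
def AcyclicPath.chartDomain {G : SimpleGraph V} {γ : ℝ} (N : ℕ) (p : AcyclicPath G γ) :
    Set (EuclideanSpace ℝ (Fin N) × ℝ) :=
  univ ×ˢ Icc p.left p.right

/-- The projection of a distribution on the manifold to layer `u`: the last variable is integrated
out over the range of layer `u`. -/
def layerProjection {N : ℕ} {G : SimpleGraph V} {γ : ℝ} (u : V)
    (μ : Measure (Manifold N G γ)) : Measure (EuclideanSpace ℝ (Fin N)) :=
  (μ.restrict {q | (q.2 : V → ℝ) ∈ layerRange G γ u}).map Prod.fst

/-- `μ` is a Gaussian cylinder on layer `u`: the image, under some chart containing the layer, of the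
product of a Gaussian and the uniform distribution on the range of the layer in that chart. -/
def IsGaussianCylinder {N : ℕ} {G : SimpleGraph V} {γ : ℝ} (u : V)
    (μ : Measure (Manifold N G γ)) : Prop :=
  ∃ (ν : Measure (EuclideanSpace ℝ (Fin N))) (p : AcyclicPath G γ) (c : ℝ),
    IsGaussian ν ∧ p.ContainsLayerAt u c ∧
    μ = (ν.prod (volume[|Icc (c - Real.sqrt γ / 2) (c + Real.sqrt γ / 2)])).map (p.chart N)

/-- `μ` is a Gaussian cylinder on layer `u` that projects to `ν`. -/
def IsCylinderLift {N : ℕ} {G : SimpleGraph V} {γ : ℝ} (u : V)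
    (ν : Measure (EuclideanSpace ℝ (Fin N))) (μ : Measure (Manifold N G γ)) : Prop :=
  IsGaussianCylinder u μ ∧ layerProjection u μ = ν

/-- `π` is a transport plan from `μ₀` to `μ₁` inside the chart `ℝ^N × p`, written in the coordinates
of the chart. There is none unless the chart carries both distributions. -/
def IsChartCoupling {N : ℕ} {G : SimpleGraph V} {γ : ℝ} (p : AcyclicPath G γ)
    (μ₀ μ₁ : Measure (Manifold N G γ))
    (π : Measure ((EuclideanSpace ℝ (Fin N) × ℝ) × (EuclideanSpace ℝ (Fin N) × ℝ))) : Prop :=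
  π (p.chartDomain N ×ˢ p.chartDomain N)ᶜ = 0 ∧
  IsCoupling (π.map (Prod.map (p.chart N) (p.chart N))) μ₀ μ₁

/-- The optimal quadratic transport cost between two distributions on the manifold: the infimum, over
all charts and all transport plans within the chart, of the squared distance in the chart. -/
def manifoldCost {N : ℕ} {G : SimpleGraph V} {γ : ℝ} (μ₀ μ₁ : Measure (Manifold N G γ)) : ℝ≥0∞ :=
  ⨅ (p : AcyclicPath G γ)
    (π : Measure ((EuclideanSpace ℝ (Fin N) × ℝ) × (EuclideanSpace ℝ (Fin N) × ℝ)))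
    (_ : IsChartCoupling p μ₀ μ₁ π),
    ∫⁻ q, ENNReal.ofReal (‖q.1.1 - q.2.1‖ ^ 2 + |q.1.2 - q.2.2| ^ 2) ∂π

/-- The transport cost on the manifold between the Gaussians `ν₀` on layer `u` and `ν₁` on layer `w`:
the least cost between Gaussian cylinders projecting to them. -/
def cylinderCost {N : ℕ} (G : SimpleGraph V) (γ : ℝ) (u w : V)
    (ν₀ ν₁ : Measure (EuclideanSpace ℝ (Fin N))) : ℝ≥0∞ :=
  ⨅ (μ₀ : Measure (Manifold N G γ)) (_ : IsCylinderLift u ν₀ μ₀)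
    (μ₁ : Measure (Manifold N G γ)) (_ : IsCylinderLift w ν₁ μ₁), manifoldCost μ₀ μ₁

end Graph

end VectorGMM

end

/-! The two terms of the cost come from two independent directions: `ℝ^N` pays at least the
Wasserstein term, and the path coordinate pays at least the squared distance of two layer centres.

Lower bound. Take a transport plan in the chart of a path `p`. Its `ℝ^N` marginals couple `ν₀` and
`ν₁`, which gives `W2 ν₀ ν₁ ^ 2`. The cylinders may have been defined through other paths, but
injective arc length parametrizations of the same arc differ by a translation or a reflection. Hence
each `z` marginal is uniform on an interval of length `√γ` whose centre is sent to `u`, respectively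
`w`, by `p` (`exists_marginal_eq_uniformLayer`). The cost in `z` is at least the squared distance of
the means, which are these centres `c`, `c'`. Finally `|c - c'| ≥ √γ * G.dist u w`
(`AcyclicPath.mul_dist_le_abs_sub`), because the linear extension of the graph distance to `u` grows
at most at unit rate along `p`.

Upper bound. A shortest path, prolonged at both ends by half an edge, is an acyclic path containing
both layers (`exists_acyclicPath_of_ne`). There any coupling of `ν₀` and `ν₁` is combined with a
rigid shift of the `z` coordinate (`manifoldCost_cylinder_le`). All bounds are independent of the
chosen lifts, so the infimum is attained by the lifts on this path. -/

namespace VectorGMM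

open Filter Topology

/-! ### Arcs of unit speed and their reparametrizations. -/

section UnitSpeed

theorem _root_.HasUnitSpeedOn.eVariationOn_Icc {X : Type*} [PseudoEMetricSpace X] {f : ℝ → X}
    {a b x y : ℝ} (hf : HasUnitSpeedOn f (Icc a b)) (hx : x ∈ Icc a b) (hy : y ∈ Icc a b) :
    eVariationOn f (Icc x y) = ENNReal.ofReal (y - x) := by
  have h := hf hx hy
  rw [inter_eq_right.2 (Icc_subset_Icc hx.1 hy.2)] at h
  simpa using h

theorem _root_.HasUnitSpeedOn.mono_Icc {X : Type*} [PseudoEMetricSpace X] {f : ℝ → X}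
    {a b a' b' : ℝ} (hf : HasUnitSpeedOn f (Icc a b)) (h : Icc a' b' ⊆ Icc a b) :
    HasUnitSpeedOn f (Icc a' b') := by
  intro x hx y hy
  rw [inter_eq_right.2 (Icc_subset_Icc hx.1 hy.2), hf.eVariationOn_Icc (h hx) (h hy)]
  simp

theorem _root_.HasUnitSpeedOn.dist_le {X : Type*} [PseudoMetricSpace X] {f : ℝ → X}
    {a b x y : ℝ} (hf : HasUnitSpeedOn f (Icc a b)) (hx : x ∈ Icc a b) (hy : y ∈ Icc a b) :
    dist (f x) (f y) ≤ |x - y| := by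
  wlog hxy : x ≤ y generalizing x y
  · rw [dist_comm, abs_sub_comm]
    exact this hy hx (le_of_not_ge hxy)
  have h := eVariationOn.edist_le f (left_mem_Icc.2 hxy) (right_mem_Icc.2 hxy)
  rw [hf.eVariationOn_Icc hx hy, edist_dist, ENNReal.ofReal_le_ofReal_iff (by linarith)] at h
  rw [abs_sub_comm, abs_of_nonneg (by linarith)]
  exact h

theorem hasUnitSpeedOn_of_dist_eq {X : Type*} [PseudoMetricSpace X] {f : ℝ → X} {a b : ℝ}
    (hf : ∀ x ∈ Icc a b, ∀ y ∈ Icc a b, dist (f x) (f y) = |x - y|) :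
    HasUnitSpeedOn f (Icc a b) := by
  refine hasConstantSpeedOnWith_iff_ordered.2 fun x hx y hy hxy => ?_
  rw [inter_eq_right.2 (Icc_subset_Icc hx.1 hy.2)]
  have h : eVariationOn f (Icc x y) = eVariationOn (fun t : ℝ => t) (Icc x y) := by
    unfold eVariationOn
    refine iSup_congr fun q => Finset.sum_congr rfl fun i _ => ?_
    have hm : ∀ j, q.2.1 j ∈ Icc a b := fun j =>
      Icc_subset_Icc hx.1 hy.2 (q.2.2.2 j)
    rw [edist_dist, edist_dist, hf _ (hm _) _ (hm _), Real.dist_eq]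
  rw [h]
  have := (monotone_id (α := ℝ)).monotoneOn (Icc x y) |>.eVariationOn_eq
    (left_mem_Icc.2 hxy) (right_mem_Icc.2 hxy)
  simpa [Function.id_def] using this

/-- A unit speed arc inside an injective unit speed arc is a translate or a reflection of a piece
of the latter. -/
theorem exists_affine_reparametrization {X : Type*} [MetricSpace X] {f g : ℝ → X}
    {a b α β : ℝ} (hαβ : α < β) (hf : Continuous f) (hfi : InjOn f (Icc a b))
    (hfs : HasUnitSpeedOn f (Icc a b)) (hg : Continuous g) (hgi : InjOn g (Icc α β))
    (hgs : HasUnitSpeedOn g (Icc α β)) (hsub : g '' Icc α β ⊆ f '' Icc a b) :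
    ∃ k : ℝ, (∀ x ∈ Icc α β, x + k ∈ Icc a b ∧ f (x + k) = g x) ∨
      (∀ x ∈ Icc α β, k - x ∈ Icc a b ∧ f (k - x) = g x) := by
  have hφ : ∀ x, ∃ y, x ∈ Icc α β → y ∈ Icc a b ∧ f y = g x := by
    intro x
    by_cases hx : x ∈ Icc α β
    · obtain ⟨y, hy, hyx⟩ := hsub (mem_image_of_mem g hx)
      exact ⟨y, fun _ => ⟨hy, hyx⟩⟩
    · exact ⟨0, fun h => absurd h hx⟩
  choose φ hφ using hφ
  -- By compactness `f` is a homeomorphism from the interval onto its image, so `φ`, which is `f⁻¹ ∘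
  -- g`, is continuous.
  have hemb : IsClosedEmbedding (fun y : Icc a b => f y) :=
    (hf.comp continuous_subtype_val).isClosedEmbedding hfi.injective
  have hc : ContinuousOn φ (Icc α β) := by
    rw [continuousOn_iff_continuous_domRestrict]
    have : Continuous fun x : Icc α β => (⟨φ x, (hφ x x.2).1⟩ : Icc a b) := by
      rw [hemb.isInducing.continuous_iff]
      have : (fun y : Icc a b => f y) ∘ (fun x : Icc α β => (⟨φ x, (hφ x x.2).1⟩ : Icc a b))
          = fun x : Icc α β => g x := by
        funext x
        exact (hφ x x.2).2
      rw [this]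
      exact hg.comp continuous_subtype_val
    exact continuous_subtype_val.comp this
  have hi : InjOn φ (Icc α β) := by
    intro x hx y hy hxy
    apply hgi hx hy
    rw [← (hφ x hx).2, ← (hφ y hy).2, hxy]
  have hα : α ∈ Icc α β := left_mem_Icc.2 hαβ.le
  have hvar : ∀ x ∈ Icc α β, eVariationOn (f ∘ φ) (Icc α x) = ENNReal.ofReal (x - α) := by
    intro x hx
    rw [← hgs.eVariationOn_Icc hα hx]
    exact eVariationOn.congr fun y hy => (hφ y (Icc_subset_Icc_right hx.2 hy)).2
  -- Being continuous and injective, `φ` is monotone or antitone. Variation is invariant under such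
  -- a reparametrization, so `φ` changes by exactly `x - α` in absolute value: a translation or a
  -- reflection.
  rcases hc.strictMonoOn_of_injOn_Icc' hαβ.le hi with hm | hm
  · refine ⟨φ α - α, Or.inl fun x hx => ?_⟩
    have h1 : φ '' Icc α x = Icc (φ α) (φ x) := by
      have hcx := hc.mono (Icc_subset_Icc_right hx.2)
      refine Subset.antisymm ?_ (intermediate_value_Icc hx.1 hcx)
      rintro _ ⟨y, hy, rfl⟩
      exact ⟨hm.monotoneOn hα (Icc_subset_Icc_right hx.2 hy) hy.1,
        hm.monotoneOn (Icc_subset_Icc_right hx.2 hy) hx hy.2⟩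
    have h2 := hvar x hx
    rw [eVariationOn.comp_eq_of_monotoneOn _ _
      (hm.monotoneOn.mono (Icc_subset_Icc_right hx.2)), h1,
      hfs.eVariationOn_Icc (hφ α hα).1 (hφ x hx).1,
      ENNReal.ofReal_eq_ofReal_iff (sub_nonneg.2 (hm.monotoneOn hα hx hx.1))
        (sub_nonneg.2 hx.1)] at h2
    have h3 : x + (φ α - α) = φ x := by linarith
    rw [h3]
    exact hφ x hx
  · refine ⟨φ α + α, Or.inr fun x hx => ?_⟩
    have h1 : φ '' Icc α x = Icc (φ x) (φ α) := by
      have hcx := hc.mono (Icc_subset_Icc_right hx.2)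
      refine Subset.antisymm ?_ (intermediate_value_Icc' hx.1 hcx)
      rintro _ ⟨y, hy, rfl⟩
      exact ⟨hm.antitoneOn (Icc_subset_Icc_right hx.2 hy) hx hy.2,
        hm.antitoneOn hα (Icc_subset_Icc_right hx.2 hy) hy.1⟩
    have h2 := hvar x hx
    rw [eVariationOn.comp_eq_of_antitoneOn _ _
      (hm.antitoneOn.mono (Icc_subset_Icc_right hx.2)), h1,
      hfs.eVariationOn_Icc (hφ x hx).1 (hφ α hα).1,
      ENNReal.ofReal_eq_ofReal_iff (sub_nonneg.2 (hm.antitoneOn hα hx hx.1))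
        (sub_nonneg.2 hx.1)] at h2
    have h3 : φ α + α - x = φ x := by linarith
    rw [h3]
    exact hφ x hx

/-- A continuous function that is `1`-Lipschitz at every point is `1`-Lipschitz. -/
theorem abs_sub_le_of_eventually_abs_sub_le {f : ℝ → ℝ} {a b : ℝ} (hab : a ≤ b)
    (hf : ContinuousOn f (Icc a b))
    (h : ∀ x ∈ Ico a b, ∀ᶠ y in 𝓝[>] x, |f y - f x| ≤ y - x) : |f b - f a| ≤ b - a := by
  -- A comparison of `|f x - f a|` with `x - a`, for which right slopes at most `1` suffice.
  have key := image_le_of_liminf_slope_right_le_deriv_boundary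
    (f := fun x => |f x - f a|) (a := a) (b := b) (B := fun x => x - a) (B' := fun _ => 1)
    ((hf.sub continuousOn_const).abs) (by simp) (by fun_prop)
    (fun x _ => ((hasDerivAt_id x).sub_const a).hasDerivWithinAt) ?_ (right_mem_Icc.2 hab)
  · exact key
  intro x hx r hr
  refine Eventually.frequently ?_
  filter_upwards [h x hx, self_mem_nhdsWithin] with y hy hxy
  have hxy' : 0 < y - x := sub_pos.2 hxy
  refine lt_of_le_of_lt ?_ hr
  rw [slope_def_field, div_le_one hxy']
  refine le_trans ?_ hy
  have := abs_sub_abs_le_abs_sub (f y - f a) (f x - f a)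
  simpa using this

end UnitSpeed

/-! ### Uniform distributions on intervals and their images on arcs. -/

section Uniform

theorem map_cond_of_measurePreserving {X : Type*} [MeasurableSpace X] {μ : Measure X}
    {e : X → X} (he : MeasurePreserving e μ μ) {t : Set X} (ht : MeasurableSet t) :
    (μ[|e ⁻¹' t]).map e = μ[|t] := by
  rw [ProbabilityTheory.cond, ProbabilityTheory.cond, Measure.map_smul,
    (he.restrict_preimage ht).map_eq, he.measure_preimage ht.nullMeasurableSet]

theorem isProbabilityMeasure_cond_Icc {a b : ℝ} (hab : a < b) :
    IsProbabilityMeasure ((volume : Measure ℝ)[|Icc a b]) :=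
  cond_isProbabilityMeasure_of_finite (by simp [hab]) (by simp)

theorem cond_Icc_compl {a b : ℝ} :
    ((volume : Measure ℝ)[|Icc a b]) (Icc a b)ᶜ = 0 := by
  rw [cond_apply measurableSet_Icc]
  simp

theorem ae_mem_of_cond_Icc {a b : ℝ} : ∀ᵐ x ∂((volume : Measure ℝ)[|Icc a b]), x ∈ Icc a b := by
  rw [ae_iff]
  exact cond_Icc_compl

theorem integral_cond_Icc {c h : ℝ} (hh : 0 < h) :
    ∫ x, x ∂((volume : Measure ℝ)[|Icc (c - h) (c + h)]) = c := by
  rw [ProbabilityTheory.cond, integral_smul_measure, integral_Icc_eq_integral_Ioc,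
    ← intervalIntegral.integral_of_le (by linarith), integral_id, Real.volume_Icc,
    ENNReal.toReal_inv, ENNReal.toReal_ofReal (by linarith), smul_eq_mul]
  have h2 : c + h - (c - h) = 2 * h := by ring
  rw [h2]
  field_simp
  ring

/-- By the Lusin–Souslin theorem `f` maps Borel subsets of `s` to Borel sets, so the push-forward
still sees every measurable subset of `s`. -/
theorem eq_of_map_eq_of_injOn {X : Type*} [MetricSpace X] [MeasurableSpace X] [BorelSpace X]
    {f : ℝ → X} {s : Set ℝ} (hs : MeasurableSet s) (hf : Continuous f) (hfi : InjOn f s)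
    {m m' : Measure ℝ} (hm : m sᶜ = 0) (hm' : m' sᶜ = 0) (h : m.map f = m'.map f) : m = m' := by
  ext A hA
  have hms : MeasurableSet (f '' (A ∩ s)) :=
    (hA.inter hs).image_of_continuousOn_injOn hf.continuousOn (hfi.mono inter_subset_right)
  have key : ∀ n : Measure ℝ, n sᶜ = 0 → n A = n.map f (f '' (A ∩ s)) := by
    intro n hn
    have hnull : ∀ B : Set ℝ, n B = n (B ∩ s) := fun B => by
      rw [← measure_inter_add_sdiff B hs,
        measure_mono_null (fun x (hx : x ∈ B \ s) => hx.2) hn, add_zero]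
    rw [Measure.map_apply hf.measurable hms, hnull A, hnull (f ⁻¹' _)]
    congr 1
    ext x
    constructor
    · exact fun hx => ⟨mem_image_of_mem f hx, hx.2⟩
    · rintro ⟨⟨y, hy, hyx⟩, hx⟩
      rwa [← hfi hy.2 hx hyx]
  rw [key m hm, key m' hm', h]

/-- A distribution on the parameter interval of an injective unit speed arc `f` whose image is the
uniform distribution on an arc `g` is itself uniform on an interval of the same length. -/
theorem eq_cond_Icc_of_map_eq {X : Type*} [MetricSpace X] [MeasurableSpace X] [BorelSpace X]
    {f g : ℝ → X} {a b c h : ℝ} (hh : 0 < h) (hf : Continuous f) (hfi : InjOn f (Icc a b))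
    (hfs : HasUnitSpeedOn f (Icc a b)) (hg : Continuous g)
    (hgi : InjOn g (Icc (c - h) (c + h))) (hgs : HasUnitSpeedOn g (Icc (c - h) (c + h)))
    {m : Measure ℝ} (hm : m (Icc a b)ᶜ = 0)
    (hmap : m.map f = (volume[|Icc (c - h) (c + h)]).map g) :
    ∃ c' ∈ Icc a b, f c' = g c ∧ m = volume[|Icc (c' - h) (c' + h)] := by
  have hK : IsClosed (f '' Icc a b) := (isCompact_Icc.image hf).isClosed
  have hnull : (volume[|Icc (c - h) (c + h)]) (g ⁻¹' (f '' Icc a b)ᶜ) = 0 := by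
    rw [← Measure.map_apply hg.measurable hK.measurableSet.compl, ← hmap,
      Measure.map_apply hf.measurable hK.measurableSet.compl]
    refine measure_mono_null ?_ hm
    exact fun x hx hx' => hx (mem_image_of_mem f hx')
  -- The parameters in the open interval that `g` sends outside the arc of `f` form an open null
  -- set, which is empty; the endpoints follow by closure.
  have hsub : g '' Icc (c - h) (c + h) ⊆ f '' Icc a b := by
    have hopen : IsOpen (Ioo (c - h) (c + h) ∩ g ⁻¹' (f '' Icc a b)ᶜ) :=
      isOpen_Ioo.inter (hK.isOpen_compl.preimage hg)
    have hz : volume (Ioo (c - h) (c + h) ∩ g ⁻¹' (f '' Icc a b)ᶜ) = 0 := by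
      rw [cond_apply measurableSet_Icc, mul_eq_zero] at hnull
      rcases hnull with h0 | h0
      · simp at h0
      · exact measure_mono_null (inter_subset_inter_left _ Ioo_subset_Icc_self) h0
    rw [hopen.measure_eq_zero_iff volume] at hz
    have h1 : Ioo (c - h) (c + h) ⊆ g ⁻¹' (f '' Icc a b) := by
      intro x hx
      by_contra hx'
      exact (hz ▸ (⟨hx, hx'⟩ : x ∈ Ioo (c - h) (c + h) ∩ g ⁻¹' (f '' Icc a b)ᶜ) : x ∈ (∅ : Set ℝ))
    have h2 := closure_minimal h1 (hK.preimage hg)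
    rw [closure_Ioo (by linarith)] at h2
    exact image_subset_iff.2 h2
  -- This treats translation and reflection together: `e` preserves Lebesgue measure and carries
  -- intervals centred at `c` to intervals centred at `e c`.
  have main : ∀ (e : ℝ → ℝ), Measurable e → MeasurePreserving e volume volume →
      (Icc (c - h) (c + h) = e ⁻¹' Icc (e c - h) (e c + h)) →
      (∀ x ∈ Icc (c - h) (c + h), e x ∈ Icc a b ∧ f (e x) = g x) →
      ∃ c' ∈ Icc a b, f c' = g c ∧ m = volume[|Icc (c' - h) (c' + h)] := by
    intro e hem he hpre hx
    have hc : c ∈ Icc (c - h) (c + h) := ⟨by linarith, by linarith⟩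
    have hmape : (volume[|Icc (c - h) (c + h)]).map e = volume[|Icc (e c - h) (e c + h)] := by
      rw [hpre]
      exact map_cond_of_measurePreserving he measurableSet_Icc
    refine ⟨e c, (hx c hc).1, (hx c hc).2, ?_⟩
    rw [← hmape]
    refine eq_of_map_eq_of_injOn measurableSet_Icc hf hfi hm ?_ ?_
    · rw [Measure.map_apply hem measurableSet_Icc.compl]
      refine measure_mono_null ?_ (cond_Icc_compl (a := c - h) (b := c + h))
      exact fun x hx1 hx2 => hx1 (hx x hx2).1
    · rw [hmap, Measure.map_map hf.measurable hem]
      refine Measure.map_congr ?_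
      filter_upwards [ae_mem_of_cond_Icc] with x hx'
      exact (hx x hx').2.symm
  obtain ⟨k, hk | hk⟩ := exists_affine_reparametrization (by linarith) hf hfi hfs hg hgi hgs hsub
  · refine main (fun x => x + k) (by fun_prop) (measurePreserving_add_right _ k) ?_ hk
    ext x
    simp only [mem_Icc, mem_preimage]
    constructor <;> rintro ⟨h1, h2⟩ <;> constructor <;> linarith
  · refine main (fun x => k - x) (by fun_prop) (volume.measurePreserving_sub_left k) ?_ hk
    ext x
    simp only [mem_Icc, mem_preimage]
    constructor <;> rintro ⟨h1, h2⟩ <;> constructor <;> linarith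

end Uniform

/-! ### Geometry of the continuous graph in the sup norm. -/

section Geometry

variable {V : Type*}

/-- The linear extension to `ℝ^V` of the graph distance to `u`. -/
noncomputable def distPotential [Fintype V] (G : SimpleGraph V) (u : V) (z : V → ℝ) : ℝ :=
  ∑ v, z v * G.dist u v

theorem continuous_distPotential [Fintype V] (G : SimpleGraph V) (u : V) :
    Continuous (distPotential G u) := by
  unfold distPotential
  fun_prop

theorem distPotential_add_smul [Fintype V] (G : SimpleGraph V) (u : V) (x y : V → ℝ) (t : ℝ) :
    distPotential G u (x + t • y) = distPotential G u x + t * distPotential G u y := by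
  simp [distPotential, add_mul, Finset.sum_add_distrib, Finset.mul_sum, mul_assoc]

theorem distPotential_sub [Fintype V] (G : SimpleGraph V) (u : V) (x y : V → ℝ) :
    distPotential G u (x - y) = distPotential G u x - distPotential G u y := by
  simp [distPotential, sub_mul, Finset.sum_sub_distrib]

theorem abs_dist_sub_dist_le_one {G : SimpleGraph V} (hG : G.Connected) (u : V) {a b : V}
    (hab : G.Adj a b) : |(G.dist u b : ℝ) - G.dist u a| ≤ 1 := by
  have h1 := hG.dist_triangle (u := u) (v := a) (w := b)
  have h2 := hG.dist_triangle (u := u) (v := b) (w := a)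
  rw [SimpleGraph.dist_eq_one_iff_adj.2 hab] at h1
  rw [SimpleGraph.dist_eq_one_iff_adj.2 hab.symm] at h2
  have h1' : (G.dist u b : ℝ) ≤ G.dist u a + 1 := by exact_mod_cast h1
  have h2' : (G.dist u a : ℝ) ≤ G.dist u b + 1 := by exact_mod_cast h2
  rw [abs_le]
  constructor <;> linarith

variable [Fintype V] [DecidableEq V]

theorem norm_vertexPoint_sub (γ : ℝ) {a b : V} (hab : a ≠ b) :
    ‖vertexPoint γ b - vertexPoint γ a‖ = Real.sqrt γ := by
  apply le_antisymm
  · refine (pi_norm_le_iff_of_nonneg (Real.sqrt_nonneg γ)).2 fun i => ?_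
    by_cases hb : i = b
    · subst hb
      simp [vertexPoint, hab.symm, abs_of_nonneg]
    · by_cases ha : i = a
      · subst ha
        simp [vertexPoint, hab, abs_of_nonneg]
      · simp [vertexPoint, hb, ha]
  · have := norm_le_pi_norm (vertexPoint γ b - vertexPoint γ a) b
    simpa [vertexPoint, hab.symm, abs_of_nonneg] using this

theorem distPotential_vertexPoint (G : SimpleGraph V) (γ : ℝ) (u v : V) :
    distPotential G u (vertexPoint γ v) = Real.sqrt γ * G.dist u v := by
  unfold distPotential vertexPoint
  rw [Finset.sum_eq_single v (fun b _ hb => by simp [hb]) (by simp)]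
  simp

/-- Only a local bound can be expected: in the sup norm all distinct vertices are `√γ` apart,
whatever their graph distance. Locally, `z` and `z'` lie on a common segment, where the potential
has slope at most `1`. -/
theorem eventually_abs_distPotential_sub_le {G : SimpleGraph V} (hG : G.Connected) {γ : ℝ}
    (u : V) (z : V → ℝ) : ∀ᶠ z' in 𝓝 z, z' ∈ contGraph G γ →
      |distPotential G u z' - distPotential G u z| ≤ ‖z' - z‖ := by
  let S : V × V → Set (V → ℝ) := fun e => (fun t : ℝ =>
    vertexPoint γ e.1 + t • (vertexPoint γ e.2 - vertexPoint γ e.1)) '' Icc (-(1 / 2)) (1 / 2)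
  have hS : ∀ e, IsClosed (S e) := fun e =>
    (isCompact_Icc.image (by fun_prop)).isClosed
  -- There are finitely many closed segments, and those missing `z` also miss a neighbourhood of
  -- `z`.
  have h : ∀ᶠ z' in 𝓝 z, ∀ e, z' ∈ S e → z ∈ S e := by
    rw [eventually_all]
    intro e
    by_cases hz : z ∈ S e
    · exact Eventually.of_forall fun _ _ => hz
    · filter_upwards [(hS e).isOpen_compl.mem_nhds hz] with z' hz' hz''
      exact absurd hz'' hz'
  filter_upwards [h] with z' hz' hmem
  obtain ⟨a, b, hab, t, ht, rfl⟩ := mem_iUnion.1 hmem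
  obtain ⟨s, hs, rfl⟩ := hz' (a, b) ⟨t, ht, rfl⟩
  simp only [distPotential_add_smul, distPotential_sub, distPotential_vertexPoint]
  have e1 : vertexPoint γ a + t • (vertexPoint γ b - vertexPoint γ a)
      - (vertexPoint γ a + s • (vertexPoint γ b - vertexPoint γ a))
      = (t - s) • (vertexPoint γ b - vertexPoint γ a) := by module
  have e2 : √γ * ↑(G.dist u a) + t * (√γ * ↑(G.dist u b) - √γ * ↑(G.dist u a)) -
      (√γ * ↑(G.dist u a) + s * (√γ * ↑(G.dist u b) - √γ * ↑(G.dist u a)))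
      = (t - s) * √γ * ((G.dist u b : ℝ) - G.dist u a) := by ring
  rw [e1, e2, norm_smul, norm_vertexPoint_sub γ hab.ne, abs_mul, abs_mul, Real.norm_eq_abs,
    abs_of_nonneg (Real.sqrt_nonneg γ)]
  exact mul_le_of_le_one_right (by positivity) (abs_dist_sub_dist_le_one hG u hab)

theorem AcyclicPath.dist_le {G : SimpleGraph V} {γ : ℝ} (p : AcyclicPath G γ) {x y : ℝ}
    (hx : x ∈ Icc p.left p.right) (hy : y ∈ Icc p.left p.right) :
    ‖(p.toFun x : V → ℝ) - p.toFun y‖ ≤ |x - y| := by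
  rw [← dist_eq_norm]
  exact p.unitSpeed.dist_le hx hy

/-- The parameters at which a path passes two vertices differ at least by the length of a shortest
path in the graph. -/
theorem AcyclicPath.mul_dist_le_abs_sub {G : SimpleGraph V} (hG : G.Connected) {γ : ℝ}
    (p : AcyclicPath G γ) {u w : V} {c c' : ℝ} (hc : c ∈ Icc p.left p.right)
    (hc' : c' ∈ Icc p.left p.right) (hu : (p.toFun c : V → ℝ) = vertexPoint γ u)
    (hw : (p.toFun c' : V → ℝ) = vertexPoint γ w) :
    Real.sqrt γ * G.dist u w ≤ |c - c'| := by
  wlog hcc : c ≤ c' generalizing u w c c'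
  · rw [abs_sub_comm, SimpleGraph.dist_comm]
    exact this hc' hc hw hu (le_of_not_ge hcc)
  have hcont : Continuous fun t => (p.toFun t : V → ℝ) :=
    continuous_subtype_val.comp p.continuous_toFun
  have hsub : Icc c c' ⊆ Icc p.left p.right := Icc_subset_Icc hc.1 hc'.2
  have key := abs_sub_le_of_eventually_abs_sub_le
    (f := fun t => distPotential G u (p.toFun t)) hcc
    ((continuous_distPotential G u).comp hcont).continuousOn ?_
  · simp only [hu, hw, distPotential_vertexPoint, SimpleGraph.dist_self] at key
    rw [abs_sub_comm, abs_of_nonneg (sub_nonneg.2 hcc)]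
    refine le_trans (le_abs_self _) ?_
    simpa using key
  · intro x hx
    have h1 := (hcont.tendsto x).eventually
      (eventually_abs_distPotential_sub_le (γ := γ) hG u (p.toFun x : V → ℝ))
    filter_upwards [h1.filter_mono nhdsWithin_le_nhds, self_mem_nhdsWithin,
      (Iio_mem_nhds hx.2 |> mem_nhdsWithin_of_mem_nhds)] with y hy hxy hyc
    refine (hy (p.toFun y).2).trans ?_
    refine (p.dist_le (hsub ⟨hx.1.trans hxy.le, hyc.le⟩) (hsub ⟨hx.1, hx.2.le⟩)).trans ?_
    exact (abs_of_nonneg (sub_nonneg.2 (le_of_lt hxy))).le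

/-- If the point is written from a vertex `a ≠ u`, its coordinate at `a` is `√γ * (1 - t)`, which
forces `t = 1 / 2`. Its coordinate at `u` then forces `b = u`, so it is the midpoint of the edge
between `a` and `u`, which both layers share. -/
theorem mem_layerRange_of_norm_sub_le {G : SimpleGraph V} {γ : ℝ} (hγ : 0 < γ) {u : V}
    {z : V → ℝ} (hz : z ∈ contGraph G γ) (h : ‖z - vertexPoint γ u‖ ≤ Real.sqrt γ / 2) :
    z ∈ layerRange G γ u := by
  obtain ⟨a, b, hab, t, ht, rfl⟩ := mem_iUnion.1 hz
  have hr : 0 < Real.sqrt γ := Real.sqrt_pos.2 hγ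
  by_cases hau : a = u
  · subst hau
    exact ⟨b, hab, t, ht, rfl⟩
  have ha := (norm_le_pi_norm _ a).trans h
  have hu := (norm_le_pi_norm _ u).trans h
  have hba : a ≠ b := hab.ne
  simp only [vertexPoint, Pi.sub_apply, Pi.add_apply, Pi.smul_apply, Pi.single_eq_same, smul_eq_mul,
    Pi.single_eq_of_ne hau, Pi.single_eq_of_ne hba, Real.norm_eq_abs, abs_le] at ha
  have ht2 : t = 1 / 2 := by
    refine le_antisymm ht.2 ?_
    have : Real.sqrt γ * (1 / 2 - t) ≤ 0 := by linarith [ha.2]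
    by_contra hlt
    have := mul_pos hr (by linarith : 0 < 1 / 2 - t)
    linarith
  by_cases hbu : b = u
  · subst hbu
    refine ⟨a, hab.symm, 1 / 2, by norm_num, ?_⟩
    rw [ht2]
    module
  · simp only [vertexPoint, Pi.sub_apply, Pi.add_apply, Pi.smul_apply, Pi.single_eq_same,
      smul_eq_mul, Pi.single_eq_of_ne (Ne.symm hau), Pi.single_eq_of_ne (Ne.symm hbu),
      Real.norm_eq_abs, abs_le] at hu
    linarith [hu.1]

end Geometry

/-! ### Gaussian cylinders and the lower bound. -/

section Cylinder

variable {V : Type*} [Fintype V] [DecidableEq V] {N : ℕ} {G : SimpleGraph V} {γ : ℝ}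

theorem AcyclicPath.measurable_chart (p : AcyclicPath G γ) : Measurable (p.chart N) :=
  measurable_fst.prodMk (p.continuous_toFun.measurable.comp measurable_snd)

theorem AcyclicPath.ContainsLayerAt.mem_Icc {p : AcyclicPath G γ} {u : V} {c : ℝ}
    (h : p.ContainsLayerAt u c) : c ∈ Icc p.left p.right :=
  h.2 ⟨by linarith [Real.sqrt_nonneg γ], by linarith [Real.sqrt_nonneg γ]⟩

theorem AcyclicPath.ContainsLayerAt.mem_layerRange (hγ : 0 < γ) {p : AcyclicPath G γ} {u : V}
    {c x : ℝ} (h : p.ContainsLayerAt u c)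
    (hx : x ∈ Icc (c - Real.sqrt γ / 2) (c + Real.sqrt γ / 2)) :
    (p.toFun x : V → ℝ) ∈ layerRange G γ u := by
  refine mem_layerRange_of_norm_sub_le hγ (p.toFun x).2 ?_
  rw [← h.1]
  refine (p.dist_le (h.2 hx) h.mem_Icc).trans ?_
  rw [abs_le]
  constructor <;> linarith [hx.1, hx.2]

/-- The uniform distribution over a layer in the coordinate of a chart. -/
noncomputable abbrev uniformLayer (γ c : ℝ) : Measure ℝ :=
  volume[|Icc (c - Real.sqrt γ / 2) (c + Real.sqrt γ / 2)]

theorem isProbabilityMeasure_uniformLayer (hγ : 0 < γ) (c : ℝ) :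
    IsProbabilityMeasure (uniformLayer γ c) :=
  isProbabilityMeasure_cond_Icc (by linarith [Real.sqrt_pos.2 hγ])

theorem map_fst_cylinder (hγ : 0 < γ) (ν : Measure (EuclideanSpace ℝ (Fin N))) [SFinite ν]
    (p : AcyclicPath G γ) (c : ℝ) :
    ((ν.prod (uniformLayer γ c)).map (p.chart N)).map Prod.fst = ν := by
  have := isProbabilityMeasure_uniformLayer hγ c
  rw [Measure.map_map measurable_fst p.measurable_chart]
  exact (Measure.map_fst_prod (μ := ν) (ν := uniformLayer γ c)).trans (by simp)

theorem map_snd_cylinder (ν : Measure (EuclideanSpace ℝ (Fin N)))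
    [IsProbabilityMeasure ν] (p : AcyclicPath G γ) (c : ℝ) :
    ((ν.prod (uniformLayer γ c)).map (p.chart N)).map Prod.snd
      = (uniformLayer γ c).map p.toFun := by
  rw [Measure.map_map measurable_snd p.measurable_chart]
  change (ν.prod (uniformLayer γ c)).map (p.toFun ∘ Prod.snd) = _
  rw [← Measure.map_map p.continuous_toFun.measurable measurable_snd, Measure.map_snd_prod]
  simp

/-- Restricting to the layer loses no mass: the path is `1`-Lipschitz, so it stays within `√γ / 2`
of the vertex on the interval carrying the uniform distribution. -/
theorem layerProjection_cylinder (hγ : 0 < γ) (ν : Measure (EuclideanSpace ℝ (Fin N)))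
    [SFinite ν] {p : AcyclicPath G γ} {u : V} {c : ℝ} (h : p.ContainsLayerAt u c) :
    layerProjection u ((ν.prod (uniformLayer γ c)).map (p.chart N)) = ν := by
  have := isProbabilityMeasure_uniformLayer hγ c
  unfold layerProjection
  rw [Measure.restrict_eq_self_of_ae_mem, map_fst_cylinder hγ]
  have hclosed : IsClosed (layerRange G γ u) := by
    have : layerRange G γ u = ⋃ w ∈ {w | G.Adj u w}, (fun t : ℝ =>
        vertexPoint γ u + t • (vertexPoint γ w - vertexPoint γ u)) '' Icc (-(1 / 2)) (1 / 2) := by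
      ext z
      simp [layerRange, eq_comm]
    rw [this]
    exact (toFinite _).isClosed_biUnion fun w _ => (isCompact_Icc.image (by fun_prop)).isClosed
  have hms : MeasurableSet {q : Manifold N G γ | (q.2 : V → ℝ) ∈ layerRange G γ u} :=
    (measurable_subtype_coe.comp measurable_snd) hclosed.measurableSet
  refine (ae_map_iff p.measurable_chart.aemeasurable hms).2 ?_
  have h2 : ∀ᵐ q ∂(ν.prod (uniformLayer γ c)),
      q.2 ∈ Icc (c - Real.sqrt γ / 2) (c + Real.sqrt γ / 2) :=
    Measure.quasiMeasurePreserving_snd.ae ae_mem_of_cond_Icc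
  filter_upwards [h2] with q hq
  exact h.mem_layerRange hγ hq

/-- Description of the lifts of `ν`. -/
theorem isCylinderLift_iff (hγ : 0 < γ) (u : V) (ν : Measure (EuclideanSpace ℝ (Fin N)))
    [IsGaussian ν] (μ : Measure (Manifold N G γ)) :
    IsCylinderLift u ν μ ↔ ∃ (p : AcyclicPath G γ) (c : ℝ), p.ContainsLayerAt u c ∧
      μ = (ν.prod (uniformLayer γ c)).map (p.chart N) := by
  constructor
  · rintro ⟨⟨ν', p, c, hν', hc, rfl⟩, hproj⟩
    rw [layerProjection_cylinder hγ ν' hc] at hproj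
    subst hproj
    exact ⟨p, c, hc, rfl⟩
  · rintro ⟨p, c, hc, rfl⟩
    exact ⟨⟨ν, p, c, inferInstance, hc, rfl⟩, layerProjection_cylinder hγ ν hc⟩

theorem W2_sq (μ ν : Measure (EuclideanSpace ℝ (Fin N))) :
    W2 μ ν ^ 2 = ⨅ (π : Measure (EuclideanSpace ℝ (Fin N) × EuclideanSpace ℝ (Fin N)))
      (_ : IsCoupling π μ ν), ∫⁻ q, ENNReal.ofReal (‖q.1 - q.2‖ ^ 2) ∂π := by
  unfold W2
  rw [← ENNReal.rpow_natCast, ← ENNReal.rpow_mul]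
  norm_num

/-- The quadratic transport cost on the line is at least the squared distance of the means. -/
theorem ofReal_sq_le_lintegral_of_integral_eq {Ω : Type*} [MeasurableSpace Ω] {π : Measure Ω}
    [IsProbabilityMeasure π] {X Y : Ω → ℝ} {c c' : ℝ} (hX : Integrable X π)
    (hY : Integrable Y π) (hXc : ∫ q, X q ∂π = c) (hYc : ∫ q, Y q ∂π = c') :
    ENNReal.ofReal ((c - c') ^ 2) ≤ ∫⁻ q, ENNReal.ofReal (|X q - Y q| ^ 2) ∂π := by
  -- This is the tangent line of the square at the mean `c - c'`. It lies below the square and is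
  -- integrable even when the square is not.
  have hint : Integrable (fun q => 2 * (c - c') * (X q - Y q) - (c - c') ^ 2) π :=
    ((hX.sub hY).const_mul _).sub (integrable_const _)
  have hval : ∫ q, (2 * (c - c') * (X q - Y q) - (c - c') ^ 2) ∂π = (c - c') ^ 2 := by
    have hs : Integrable (fun q => 2 * (c - c') * (X q - Y q)) π := (hX.sub hY).const_mul _
    rw [integral_sub hs (integrable_const _), integral_const_mul,
      integral_sub hX hY, hXc, hYc]
    simp only [integral_const, probReal_univ, smul_eq_mul]
    ring
  rw [← hval, integral_eq_lintegral_pos_part_sub_lintegral_neg_part hint]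
  refine (ENNReal.ofReal_le_ofReal (sub_le_self _ ENNReal.toReal_nonneg)).trans
    (ENNReal.ofReal_toReal_le.trans (lintegral_mono fun q => ENNReal.ofReal_le_ofReal ?_))
  rw [sq_abs]
  nlinarith [sq_nonneg (X q - Y q - (c - c'))]

/-- Whichever path `p₀` defined the cylinder, the chart of `p` sees it as uniform around a passage
through `u`. -/
theorem exists_marginal_eq_uniformLayer (hγ : 0 < γ) {p p₀ : AcyclicPath G γ} {u : V} {c₀ : ℝ}
    (h₀ : p₀.ContainsLayerAt u c₀) {m : Measure ℝ} (hm : m (Icc p.left p.right)ᶜ = 0)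
    (hmap : m.map p.toFun = (uniformLayer γ c₀).map p₀.toFun) :
    ∃ c ∈ Icc p.left p.right, (p.toFun c : V → ℝ) = vertexPoint γ u ∧ m = uniformLayer γ c := by
  obtain ⟨c, hc, hcu, hmc⟩ := eq_cond_Icc_of_map_eq (half_pos (Real.sqrt_pos.2 hγ))
    p.continuous_toFun p.injOn p.unitSpeed p₀.continuous_toFun (p₀.injOn.mono h₀.2)
    (p₀.unitSpeed.mono_Icc h₀.2) hm hmap
  exact ⟨c, hc, by rw [hcu, h₀.1], hmc⟩

theorem integrable_of_map_eq_uniformLayer {Ω : Type*} [MeasurableSpace Ω] {π : Measure Ω}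
    (hγ : 0 < γ) {X : Ω → ℝ} {c : ℝ} (hX : Measurable X) (h : π.map X = uniformLayer γ c) :
    Integrable X π ∧ ∫ q, X q ∂π = c := by
  have := isProbabilityMeasure_uniformLayer hγ c
  have hid : Integrable (fun x : ℝ => x) (uniformLayer γ c) := by
    refine Integrable.of_bound (by fun_prop) (|c| + Real.sqrt γ / 2) ?_
    filter_upwards [ae_mem_of_cond_Icc] with x hx
    rw [Real.norm_eq_abs, abs_le]
    constructor <;> linarith [hx.1, hx.2, le_abs_self c, neg_abs_le c]
  constructor
  · rw [← h] at hid
    exact hid.comp_measurable hX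
  · rw [← integral_cond_Icc (c := c) (half_pos (Real.sqrt_pos.2 hγ)), ← uniformLayer, ← h,
      integral_map hX.aemeasurable (by fun_prop)]

theorem le_manifoldCost (hG : G.Connected) (hγ : 0 < γ) (u w : V)
    (ν₀ ν₁ : Measure (EuclideanSpace ℝ (Fin N))) [IsGaussian ν₀] [IsGaussian ν₁]
    {μ₀ μ₁ : Measure (Manifold N G γ)} (h₀ : IsCylinderLift u ν₀ μ₀)
    (h₁ : IsCylinderLift w ν₁ μ₁) :
    W2 ν₀ ν₁ ^ 2 + ENNReal.ofReal (γ * (G.dist u w : ℝ) ^ 2) ≤ manifoldCost μ₀ μ₁ := by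
  obtain ⟨p₀, c₀, hc₀, rfl⟩ := (isCylinderLift_iff hγ u ν₀ μ₀).1 h₀
  obtain ⟨p₁, c₁, hc₁, rfl⟩ := (isCylinderLift_iff hγ w ν₁ μ₁).1 h₁
  refine le_iInf fun p => le_iInf fun π => le_iInf fun hπ => ?_
  obtain ⟨hdom, hfst, hsnd⟩ := hπ
  have hchart := p.measurable_chart (N := N)
  rw [Measure.map_map measurable_fst (hchart.prodMap hchart)] at hfst
  rw [Measure.map_map measurable_snd (hchart.prodMap hchart)] at hsnd
  have hx : π.map (fun q => q.1.1) = ν₀ := by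
    rw [← map_fst_cylinder hγ ν₀ p₀ c₀, ← hfst,
      Measure.map_map measurable_fst (measurable_fst.comp (hchart.prodMap hchart))]
    rfl
  have hy : π.map (fun q => q.2.1) = ν₁ := by
    rw [← map_fst_cylinder hγ ν₁ p₁ c₁, ← hsnd,
      Measure.map_map measurable_fst (measurable_snd.comp (hchart.prodMap hchart))]
    rfl
  have hprob : IsProbabilityMeasure π := by
    have : IsProbabilityMeasure (π.map fun q => q.1.1) := by rw [hx]; infer_instance
    exact π.isProbabilityMeasure_of_map fun q => q.1.1
  have hz₀ : (π.map fun q => q.1.2).map p.toFun = (uniformLayer γ c₀).map p₀.toFun := by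
    rw [← map_snd_cylinder ν₀, ← hfst, Measure.map_map p.continuous_toFun.measurable (by fun_prop),
      Measure.map_map measurable_snd (measurable_fst.comp (hchart.prodMap hchart))]
    rfl
  have hz₁ : (π.map fun q => q.2.2).map p.toFun = (uniformLayer γ c₁).map p₁.toFun := by
    rw [← map_snd_cylinder ν₁, ← hsnd, Measure.map_map p.continuous_toFun.measurable (by fun_prop),
      Measure.map_map measurable_snd (measurable_snd.comp (hchart.prodMap hchart))]
    rfl
  have hs₀ : (π.map fun q => q.1.2) (Icc p.left p.right)ᶜ = 0 := by
    rw [Measure.map_apply (by fun_prop) measurableSet_Icc.compl]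
    refine measure_mono_null ?_ hdom
    exact fun q hq hq' => hq hq'.1.2
  have hs₁ : (π.map fun q => q.2.2) (Icc p.left p.right)ᶜ = 0 := by
    rw [Measure.map_apply (by fun_prop) measurableSet_Icc.compl]
    refine measure_mono_null ?_ hdom
    exact fun q hq hq' => hq hq'.2.2
  obtain ⟨c, hc, hcu, hmc⟩ := exists_marginal_eq_uniformLayer hγ hc₀ hs₀ hz₀
  obtain ⟨c', hc', hcw, hmc'⟩ := exists_marginal_eq_uniformLayer hγ hc₁ hs₁ hz₁
  obtain ⟨hi, hmean⟩ := integrable_of_map_eq_uniformLayer hγ (by fun_prop) hmc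
  obtain ⟨hi', hmean'⟩ := integrable_of_map_eq_uniformLayer hγ (by fun_prop) hmc'
  have hsplit : ∫⁻ q, ENNReal.ofReal (‖q.1.1 - q.2.1‖ ^ 2 + |q.1.2 - q.2.2| ^ 2) ∂π
      = ∫⁻ q, ENNReal.ofReal (‖q.1.1 - q.2.1‖ ^ 2) ∂π
        + ∫⁻ q, ENNReal.ofReal (|q.1.2 - q.2.2| ^ 2) ∂π := by
    rw [← lintegral_add_left (by fun_prop)]
    exact lintegral_congr fun q => ENNReal.ofReal_add (by positivity) (by positivity)
  rw [hsplit]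
  refine add_le_add ?_ ?_
  · rw [W2_sq]
    have hcoup : IsCoupling (π.map fun q => (q.1.1, q.2.1)) ν₀ ν₁ := by
      constructor
      · rw [Measure.map_map measurable_fst (by fun_prop)]
        exact hx
      · rw [Measure.map_map measurable_snd (by fun_prop)]
        exact hy
    refine iInf₂_le_of_le _ hcoup ?_
    rw [lintegral_map (by fun_prop) (by fun_prop)]
  · refine le_trans (ENNReal.ofReal_le_ofReal ?_)
      (ofReal_sq_le_lintegral_of_integral_eq hi hi' hmean hmean')
    have h1 := p.mul_dist_le_abs_sub hG hc hc' hcu hcw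
    calc γ * (G.dist u w : ℝ) ^ 2 = (Real.sqrt γ * G.dist u w) ^ 2 := by
          rw [mul_pow, Real.sq_sqrt hγ.le]
      _ ≤ |c - c'| ^ 2 := pow_le_pow_left₀ (by positivity) h1 2
      _ = (c - c') ^ 2 := sq_abs _

end Cylinder

/-! ### Polygonal lines of unit speed. -/

section Polyline

variable {E : Type*} [NormedAddCommGroup E] [NormedSpace ℝ E]

/-- The polygonal line through `P 0, …, P m`, running through each of its edges in time `r`. -/
noncomputable def polyline (P : ℕ → E) (r : ℝ) (m : ℕ) (t : ℝ) : E :=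
  P 0 + ∑ i ∈ Finset.range m, max 0 (min 1 (t / r - i)) • (P (i + 1) - P i)

theorem continuous_polyline (P : ℕ → E) (r : ℝ) (m : ℕ) : Continuous (polyline P r m) := by
  unfold polyline
  fun_prop

theorem polyline_eq (P : ℕ → E) {r : ℝ} (hr : 0 < r) {m k : ℕ} (hk : k < m) {t : ℝ}
    (ht : t ∈ Icc (k * r) ((k + 1) * r)) :
    polyline P r m t = P k + (t / r - k) • (P (k + 1) - P k) := by
  have h1 : (k : ℝ) ≤ t / r := (le_div_iff₀ hr).2 ht.1
  have h2 : t / r ≤ k + 1 := (div_le_iff₀ hr).2 ht.2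
  -- On edge `k` the coefficients of earlier edges are clamped to `1`, and their sum telescopes;
  -- those of later edges are clamped to `0`.
  have hlow : ∑ i ∈ Finset.range k, max 0 (min 1 (t / r - i)) • (P (i + 1) - P i)
      = P k - P 0 := by
    rw [← Finset.sum_range_sub]
    refine Finset.sum_congr rfl fun i hi => ?_
    have hik : (i : ℝ) + 1 ≤ k := by exact_mod_cast Finset.mem_range.1 hi
    rw [min_eq_left (by linarith), max_eq_right zero_le_one, one_smul]
  unfold polyline
  induction m, hk using Nat.le_induction with
  | base =>
    rw [Finset.sum_range_succ, hlow, min_eq_right (by linarith), max_eq_right (by linarith)]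
    abel
  | succ n hn ih =>
    have hkn : (k : ℝ) + 1 ≤ n := by exact_mod_cast hn
    rw [Finset.sum_range_succ, ← add_assoc, ih, min_eq_right (by linarith),
      max_eq_left (by linarith), zero_smul, add_zero]

theorem exists_mem_Icc_mul {r : ℝ} {m : ℕ} (hm : 0 < m) {t : ℝ}
    (ht : t ∈ Icc 0 (m * r)) : ∃ k < m, t ∈ Icc (k * r) ((k + 1) * r) := by
  induction m, hm using Nat.le_induction with
  | base => exact ⟨0, by simp, by simpa using ht⟩
  | succ n hn ih =>
    rcases le_total t (n * r) with h | h
    · obtain ⟨k, hk, hkt⟩ := ih ⟨ht.1, h⟩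
      exact ⟨k, by omega, hkt⟩
    · exact ⟨n, by omega, h, by simpa using ht.2⟩

theorem hasUnitSpeedOn_polyline (P : ℕ → E) {r : ℝ} (hr : 0 < r) (m : ℕ)
    (hP : ∀ i < m, ‖P (i + 1) - P i‖ = r) :
    HasUnitSpeedOn (polyline P r m) (Icc 0 (m * r)) := by
  have key : ∀ k ≤ m, HasUnitSpeedOn (polyline P r m) (Icc 0 (k * r)) := by
    intro k
    induction k with
    | zero =>
      intro _
      refine hasUnitSpeedOn_of_dist_eq fun x hx y hy => ?_
      simp only [Nat.cast_zero, zero_mul, Icc_self, mem_singleton_iff] at hx hy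
      simp [hx, hy]
    | succ k ih =>
      intro hk
      refine (ih (by omega)).Icc_Icc (hasUnitSpeedOn_of_dist_eq fun x hx y hy => ?_)
      push_cast at hx hy
      rw [polyline_eq P hr (by omega : k < m) hx, polyline_eq P hr (by omega : k < m) hy,
        dist_add_left, dist_eq_norm, ← sub_smul, norm_smul, hP k (by omega),
        Real.norm_eq_abs, ← abs_of_pos hr, ← abs_mul, abs_of_pos hr]
      congr 1
      field_simp
      ring
  exact key m le_rfl

end Polyline

/-! ### An acyclic path along a shortest path of the graph. -/

section Geodesic

variable {V : Type*}

/-- A shortest path as a sequence of vertices. -/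
theorem exists_geodesic {G : SimpleGraph V} (hG : G.Connected) (u w : V) :
    ∃ v : ℕ → V, v 0 = u ∧ v (G.dist u w) = w ∧
      (∀ i < G.dist u w, G.Adj (v i) (v (i + 1))) ∧ ∀ i ≤ G.dist u w, G.dist u (v i) = i := by
  obtain ⟨q, hq⟩ := hG.exists_walk_length_eq_dist u w
  refine ⟨q.getVert, by simp, by simp [← hq], fun i hi => q.adj_getVert_succ (by omega),
    fun i hi => ?_⟩
  -- The two pieces of the walk have lengths `i` and `G.dist u w - i`; a shorter way to the `i`-th
  -- vertex would contradict the triangle inequality.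
  have h1 := SimpleGraph.dist_le (q.take i)
  have h2 := SimpleGraph.dist_le (q.drop i)
  have h3 := hG.dist_triangle (u := u) (v := q.getVert i) (w := w)
  simp only [SimpleGraph.Walk.take_length, SimpleGraph.Walk.drop_length] at h1 h2
  omega

variable [DecidableEq V]

/-- The vertices of a sequence, shifted by one, with the first and the last edge prolonged beyond
the ends by their own length. -/
noncomputable def prolongedVertices (γ : ℝ) (v : ℕ → V) (n : ℕ) (j : ℕ) : V → ℝ :=
  if j = 0 then vertexPoint γ (v 0) - (vertexPoint γ (v 1) - vertexPoint γ (v 0))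
  else if j ≤ n + 1 then vertexPoint γ (v (j - 1))
  else vertexPoint γ (v n) - (vertexPoint γ (v (n - 1)) - vertexPoint γ (v n))

theorem prolongedVertices_zero (γ : ℝ) (v : ℕ → V) (n : ℕ) : prolongedVertices γ v n 0 =
    vertexPoint γ (v 0) - (vertexPoint γ (v 1) - vertexPoint γ (v 0)) := by
  simp [prolongedVertices]

theorem prolongedVertices_succ (γ : ℝ) (v : ℕ → V) {n i : ℕ} (hi : i ≤ n) :
    prolongedVertices γ v n (i + 1) = vertexPoint γ (v i) := by
  simp [prolongedVertices, hi]

theorem prolongedVertices_last (γ : ℝ) (v : ℕ → V) (n : ℕ) :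
    prolongedVertices γ v n (n + 2) =
      vertexPoint γ (v n) - (vertexPoint γ (v (n - 1)) - vertexPoint γ (v n)) := by
  simp [prolongedVertices]

variable [Fintype V]

/-- A path that follows a shortest path from `u` to `w` and contains the layers at both ends. -/
theorem exists_acyclicPath_of_ne {G : SimpleGraph V} (hG : G.Connected) {γ : ℝ} (hγ : 0 < γ)
    {u w : V} (huw : u ≠ w) : ∃ (p : AcyclicPath G γ) (c : ℝ), p.ContainsLayerAt u c ∧
      p.ContainsLayerAt w (c + Real.sqrt γ * G.dist u w) := by
  obtain ⟨v, hv0, hvn, hadj, hdist⟩ := exists_geodesic hG u w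
  have hn : 0 < G.dist u w := hG.pos_dist_of_ne huw
  generalize G.dist u w = n at *
  set r := Real.sqrt γ with hr_def
  have hr : 0 < r := Real.sqrt_pos.2 hγ
  set P := prolongedVertices γ v n with hP
  have hP0 : P 0 = vertexPoint γ (v 0) - (vertexPoint γ (v 1) - vertexPoint γ (v 0)) :=
    prolongedVertices_zero γ v n
  have hPs : ∀ i ≤ n, P (i + 1) = vertexPoint γ (v i) :=
    fun i hi => prolongedVertices_succ γ v hi
  have hPl : P (n + 2) =
      vertexPoint γ (v n) - (vertexPoint γ (v (n - 1)) - vertexPoint γ (v n)) :=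
    prolongedVertices_last γ v n
  have hadj0 : G.Adj (v 0) (v 1) := hadj 0 hn
  have hadjn : G.Adj (v (n - 1)) (v n) := by
    have := hadj (n - 1) (by omega)
    rwa [Nat.sub_add_cancel hn] at this
  have hcases : ∀ k < n + 2, k = 0 ∨ (∃ i < n, k = i + 1) ∨ k = n + 1 := by
    intro k hk
    rcases Nat.eq_zero_or_pos k with h | h
    · exact Or.inl h
    · rcases Nat.lt_or_ge k (n + 1) with h' | h'
      · exact Or.inr (Or.inl ⟨k - 1, by omega, by omega⟩)
      · exact Or.inr (Or.inr (by omega))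
  have hstep : ∀ k < n + 2, ‖P (k + 1) - P k‖ = r := by
    intro k hk
    rcases hcases k hk with rfl | ⟨i, hi, rfl⟩ | rfl
    · rw [hPs 0 (by omega), hP0, sub_sub_cancel]
      exact norm_vertexPoint_sub γ hadj0.ne
    · rw [hPs (i + 1) (by omega), hPs i (by omega)]
      exact norm_vertexPoint_sub γ (hadj i hi).ne
    · rw [hPl, hPs n le_rfl, sub_sub_cancel_left, norm_neg]
      exact norm_vertexPoint_sub γ hadjn.ne.symm
  -- The potential rises by `r` on every edge, the prolonged ones included. It therefore equals `t -
  -- r` along the polyline, which yields injectivity.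
  have hpot : ∀ k < n + 2, distPotential G u (P k) = r * (k - 1) ∧
      distPotential G u (P (k + 1) - P k) = r := by
    have hvp : ∀ i ≤ n, distPotential G u (vertexPoint γ (v i)) = r * i := fun i hi => by
      rw [distPotential_vertexPoint, hdist i hi]
    intro k hk
    rcases hcases k hk with rfl | ⟨i, hi, rfl⟩ | rfl
    · rw [hPs 0 (by omega), hP0, sub_sub_cancel]
      simp only [distPotential_sub, hvp 0 (by omega), hvp 1 (by omega)]
      constructor <;> push_cast <;> ring
    · rw [hPs (i + 1) (by omega), hPs i (by omega), distPotential_sub, hvp i (by omega),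
        hvp (i + 1) (by omega)]
      constructor <;> push_cast <;> ring
    · rw [hPl, hPs n le_rfl, sub_sub_cancel_left, neg_sub, distPotential_sub, hvp n le_rfl,
        hvp (n - 1) (by omega), Nat.cast_sub hn]
      constructor <;> push_cast <;> ring
  let q := polyline P r (n + 2)
  have hq : Continuous q := continuous_polyline P r (n + 2)
  have hqs : HasUnitSpeedOn q (Icc 0 ((n + 2 : ℕ) * r)) :=
    hasUnitSpeedOn_polyline P hr (n + 2) hstep
  have hqpot : ∀ t ∈ Icc 0 ((n + 2 : ℕ) * r), distPotential G u (q t) = t - r := by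
    intro t ht
    obtain ⟨k, hk, hkt⟩ := exists_mem_Icc_mul (by omega) ht
    change distPotential G u (polyline P r (n + 2) t) = _
    rw [polyline_eq P hr hk hkt, distPotential_add_smul, (hpot k hk).1, (hpot k hk).2]
    field_simp
    ring
  -- Only the inner half of each prolonged edge lies in the continuous graph, as the part with
  -- negative parameter of the layer at that end.
  have hqm : ∀ t ∈ Icc (r / 2) ((n + 1) * r + r / 2), q t ∈ contGraph G γ := by
    intro t ht
    obtain ⟨k, hk, hkt⟩ := exists_mem_Icc_mul (by omega : 0 < n + 2)
      (⟨by linarith [ht.1], by push_cast; linarith [ht.2]⟩ : t ∈ Icc 0 ((n + 2 : ℕ) * r))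
    have e : q t = _ := polyline_eq P hr hk hkt
    have h1 : (k : ℝ) ≤ t / r := (le_div_iff₀ hr).2 hkt.1
    have h2 : t / r ≤ k + 1 := (div_le_iff₀ hr).2 hkt.2
    have h3 : 1 / 2 ≤ t / r := (le_div_iff₀ hr).2 (by linarith [ht.1])
    have h4 : t / r ≤ n + 1 + 1 / 2 := (div_le_iff₀ hr).2 (by linarith [ht.2])
    rw [e]
    rcases hcases k hk with rfl | ⟨i, hi, rfl⟩ | rfl
    · refine mem_iUnion.2 ⟨v 0, v 1, hadj0, t / r - 1,
        ⟨by linarith, by push_cast at h2; linarith⟩, ?_⟩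
      rw [hPs 0 (by omega), hP0]
      push_cast
      module
    · rw [hPs (i + 1) (by omega), hPs i (by omega)]
      rcases le_total (t / r - (i + 1 : ℕ)) (1 / 2) with h | h
      · exact mem_iUnion.2 ⟨v i, v (i + 1), hadj i hi, _, ⟨by linarith, h⟩, rfl⟩
      · refine mem_iUnion.2 ⟨v (i + 1), v i, (hadj i hi).symm, 1 - (t / r - (i + 1 : ℕ)),
          ⟨by linarith, by linarith⟩, ?_⟩
        module
    · refine mem_iUnion.2 ⟨v n, v (n - 1), hadjn.symm, -(t / r - (n + 1 : ℕ)),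
        ⟨by push_cast; linarith, by linarith⟩, ?_⟩
      rw [hPl, hPs n le_rfl]
      module
  have hlr : r / 2 < (n + 1) * r + r / 2 := by
    have : 0 < ((n : ℝ) + 1) * r := by positivity
    linarith
  have hsub : Icc (r / 2) ((n + 1) * r + r / 2) ⊆ Icc 0 ((n + 2 : ℕ) * r) := by
    refine Icc_subset_Icc (by linarith) ?_
    push_cast
    linarith
  -- Clamping the parameter gives a continuous map on all of `ℝ` with values in the continuous
  -- graph.
  let f : ℝ → contGraph G γ := fun t => ⟨q (projIcc _ _ hlr.le t), hqm _ (projIcc _ _ hlr.le t).2⟩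
  have hf : ∀ t ∈ Icc (r / 2) ((n + 1) * r + r / 2), (f t : V → ℝ) = q t := by
    intro t ht
    change q (projIcc _ _ hlr.le t) = q t
    rw [projIcc_of_mem hlr.le ht]
  have hqk : ∀ i ≤ n, q ((i + 1) * r) = vertexPoint γ (v i) := by
    intro i hi
    have e := polyline_eq P hr (by omega : i + 1 < n + 2) (t := (i + 1) * r)
      ⟨by push_cast; linarith, by push_cast; linarith⟩
    have e2 : (i + 1) * r / r - ((i + 1 : ℕ) : ℝ) = 0 := by
      rw [mul_div_cancel_right₀ _ hr.ne']
      push_cast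
      ring
    rw [e2, zero_smul, add_zero, hPs i hi] at e
    exact e
  let p : AcyclicPath G γ :=
    { left := r / 2
      right := (n + 1) * r + r / 2
      left_lt_right := hlr
      toFun := f
      continuous_toFun :=
        (hq.comp (continuous_subtype_val.comp continuous_projIcc)).subtype_mk _
      injOn := by
        intro x hx y hy hxy
        have h := congrArg (fun z : contGraph G γ => distPotential G u z) hxy
        simp only [hf x hx, hf y hy, hqpot x (hsub hx), hqpot y (hsub hy)] at h
        linarith
      unitSpeed := by
        intro x hx y hy
        rw [← (hqs.mono_Icc hsub) hx hy]
        calc eVariationOn f (Icc (r / 2) ((n + 1) * r + r / 2) ∩ Icc x y)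
            = eVariationOn (fun t => (f t : V → ℝ))
              (Icc (r / 2) ((n + 1) * r + r / 2) ∩ Icc x y) := rfl
          _ = eVariationOn q _ := eVariationOn.congr fun t ht => hf t ht.1 }
  have hn' : 0 ≤ (n : ℝ) * r := by positivity
  -- The centre is `r` since the prolonged edge before `u` takes the time from `0` to `r`.
  refine ⟨p, r, ⟨?_, ?_⟩, ⟨?_, ?_⟩⟩
  · refine (hf r ⟨by linarith, by linarith⟩).trans ?_
    have := hqk 0 (by omega)
    rw [hv0] at this
    simpa using this
  · exact Icc_subset_Icc (by change r / 2 ≤ _; linarith)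
      (by change _ ≤ (n + 1) * r + r / 2; linarith)
  · have e : r + r * n = (n + 1) * r := by ring
    rw [e]
    refine (hf _ ⟨by linarith, by linarith⟩).trans ?_
    rw [hqk n le_rfl, hvn]
  · exact Icc_subset_Icc (by change r / 2 ≤ _; linarith)
      (by change _ ≤ (n + 1) * r + r / 2; linarith)

theorem exists_acyclicPath [Nontrivial V] {G : SimpleGraph V} (hG : G.Connected) {γ : ℝ}
    (hγ : 0 < γ) (u w : V) : ∃ (p : AcyclicPath G γ) (c : ℝ), p.ContainsLayerAt u c ∧
      p.ContainsLayerAt w (c + Real.sqrt γ * G.dist u w) := by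
  by_cases huw : u = w
  · subst huw
    -- A path towards any other vertex contains the layer of `u`; this is where a second vertex is
    -- needed.
    obtain ⟨b, hb⟩ := exists_ne u
    obtain ⟨p, c, hp, -⟩ := exists_acyclicPath_of_ne hG hγ hb.symm
    exact ⟨p, c, hp, by simpa using hp⟩
  · exact exists_acyclicPath_of_ne hG hγ huw

end Geodesic

/-! ### The upper bound by a rigid shift along the path. -/

section UpperBound

variable {V : Type*} [Fintype V] [DecidableEq V] {N : ℕ} {G : SimpleGraph V} {γ : ℝ}

theorem map_add_right_uniformLayer (γ c d : ℝ) :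
    (uniformLayer γ c).map (fun x => x + d) = uniformLayer γ (c + d) := by
  have h : Icc (c - √γ / 2) (c + √γ / 2)
      = (fun x => x + d) ⁻¹' Icc (c + d - √γ / 2) (c + d + √γ / 2) := by
    ext x
    simp only [mem_Icc, mem_preimage]
    constructor <;> rintro ⟨h1, h2⟩ <;> constructor <;> linarith
  rw [uniformLayer, h]
  exact map_cond_of_measurePreserving (measurePreserving_add_right volume d) measurableSet_Icc

theorem manifoldCost_cylinder_le (hγ : 0 < γ) {u w : V}
    (ν₀ ν₁ : Measure (EuclideanSpace ℝ (Fin N))) [IsProbabilityMeasure ν₀]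
    [IsProbabilityMeasure ν₁] {p : AcyclicPath G γ} {c d : ℝ} (hc : p.ContainsLayerAt u c)
    (hd : p.ContainsLayerAt w (c + d)) :
    manifoldCost ((ν₀.prod (uniformLayer γ c)).map (p.chart N))
      ((ν₁.prod (uniformLayer γ (c + d))).map (p.chart N))
      ≤ W2 ν₀ ν₁ ^ 2 + ENNReal.ofReal (d ^ 2) := by
  have hU := isProbabilityMeasure_uniformLayer hγ c
  rw [W2_sq, ENNReal.iInf_add]
  refine le_iInf fun π => ?_
  by_cases hπ : IsCoupling π ν₀ ν₁
  swap
  · simp [hπ]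
  rw [iInf_pos hπ]
  obtain ⟨hfst, hsnd⟩ := hπ
  have hprob : IsProbabilityMeasure π := by
    have : IsProbabilityMeasure (π.map Prod.fst) := by rw [hfst]; infer_instance
    exact π.isProbabilityMeasure_of_map Prod.fst
  have hchart := p.measurable_chart (N := N)
  -- The plan draws `(x, y)` from `π` and an independent uniform `z`, and sends `(x, z)` to `(y, z +
  -- d)`; the path coordinate then costs exactly `d ^ 2`.
  let T : (EuclideanSpace ℝ (Fin N) × EuclideanSpace ℝ (Fin N)) × ℝ →
      (EuclideanSpace ℝ (Fin N) × ℝ) × (EuclideanSpace ℝ (Fin N) × ℝ) :=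
    fun q => ((q.1.1, q.2), (q.1.2, q.2 + d))
  have hT : Measurable T := by fun_prop
  have hT₀ : ((π.prod (uniformLayer γ c)).map T).map Prod.fst = ν₀.prod (uniformLayer γ c) := by
    rw [Measure.map_map measurable_fst hT, ← hfst]
    nth_rewrite 2 [← Measure.map_id (μ := uniformLayer γ c)]
    rw [Measure.map_prod_map _ _ measurable_fst measurable_id]
    rfl
  have hT₁ : ((π.prod (uniformLayer γ c)).map T).map Prod.snd
      = ν₁.prod (uniformLayer γ (c + d)) := by
    rw [Measure.map_map measurable_snd hT, ← hsnd, ← map_add_right_uniformLayer,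
      Measure.map_prod_map _ _ measurable_snd (by fun_prop)]
    rfl
  refine (iInf_le_of_le p (iInf₂_le_of_le ((π.prod (uniformLayer γ c)).map T) ⟨?_, ?_, ?_⟩ ?_))
  · have hdom : MeasurableSet (p.chartDomain N) := MeasurableSet.univ.prod measurableSet_Icc
    rw [Measure.map_apply hT (hdom.prod hdom).compl]
    have h2 : ∀ᵐ q ∂(π.prod (uniformLayer γ c)),
        q.2 ∈ Icc (c - Real.sqrt γ / 2) (c + Real.sqrt γ / 2) :=
      Measure.quasiMeasurePreserving_snd.ae ae_mem_of_cond_Icc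
    refine measure_mono_null ?_ (ae_iff.1 h2)
    intro q hq hq'
    exact hq ⟨⟨mem_univ _, hc.2 hq'⟩, ⟨mem_univ _,
      hd.2 ⟨by linarith [hq'.1], by linarith [hq'.2]⟩⟩⟩
  · rw [Measure.map_map measurable_fst (hchart.prodMap hchart), ← hT₀,
      Measure.map_map hchart measurable_fst]
    rfl
  · rw [Measure.map_map measurable_snd (hchart.prodMap hchart), ← hT₁,
      Measure.map_map hchart measurable_snd]
    rfl
  · rw [lintegral_map (by fun_prop) hT]
    have e : ∀ q : (EuclideanSpace ℝ (Fin N) × EuclideanSpace ℝ (Fin N)) × ℝ,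
        ENNReal.ofReal (‖(T q).1.1 - (T q).2.1‖ ^ 2 + |(T q).1.2 - (T q).2.2| ^ 2)
          = ENNReal.ofReal (‖q.1.1 - q.1.2‖ ^ 2) + ENNReal.ofReal (d ^ 2) := by
      intro q
      rw [← ENNReal.ofReal_add (by positivity) (by positivity)]
      simp [T]
    simp only [e]
    rw [lintegral_add_right _ measurable_const, lintegral_const, measure_univ, mul_one,
      lintegral_prod _ (by fun_prop)]
    simp

end UpperBound

end VectorGMM

theorem theorem3 {N : ℕ} {V : Type*} [Fintype V] [DecidableEq V] [Nontrivial V]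
    (G : SimpleGraph V) (hG : G.Connected) (γ : ℝ) (hγ : 0 < γ) (u w : V)
    (ν₀ ν₁ : MeasureTheory.Measure (EuclideanSpace ℝ (Fin N)))
    [ProbabilityTheory.IsGaussian ν₀] [ProbabilityTheory.IsGaussian ν₁] :
    VectorGMM.cylinderCost G γ u w ν₀ ν₁ =
        VectorGMM.W2 ν₀ ν₁ ^ 2 + ENNReal.ofReal (γ * (G.dist u w : ℝ) ^ 2) ∧
      ∃ μ₀ μ₁ : MeasureTheory.Measure (VectorGMM.Manifold N G γ),
        VectorGMM.IsCylinderLift u ν₀ μ₀ ∧ VectorGMM.IsCylinderLift w ν₁ μ₁ ∧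
        VectorGMM.manifoldCost μ₀ μ₁ =
          VectorGMM.W2 ν₀ ν₁ ^ 2 + ENNReal.ofReal (γ * (G.dist u w : ℝ) ^ 2) := by
  obtain ⟨p, c, hu, hw⟩ := VectorGMM.exists_acyclicPath hG hγ u w
  have h₀ := (VectorGMM.isCylinderLift_iff hγ u ν₀ _).2 ⟨p, c, hu, rfl⟩
  have h₁ := (VectorGMM.isCylinderLift_iff hγ w ν₁ _).2 ⟨p, _, hw, rfl⟩
  have hle := VectorGMM.manifoldCost_cylinder_le hγ ν₀ ν₁ hu hw
  rw [mul_pow, Real.sq_sqrt hγ.le] at hle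
  refine ⟨le_antisymm ?_ ?_, _, _, h₀, h₁,
    le_antisymm hle (VectorGMM.le_manifoldCost hG hγ u w ν₀ ν₁ h₀ h₁)⟩
  · exact (iInf₂_le_of_le _ h₀ (iInf₂_le_of_le _ h₁ hle))
  · exact le_iInf₂ fun μ₀ hμ₀ => le_iInf₂ fun μ₁ hμ₁ =>
      VectorGMM.le_manifoldCost hG hγ u w ν₀ ν₁ hμ₀ hμ₁
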